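/- Let $\omega_1$ be the first uncountable ordinal with its order topology, and give each $S \subseteq \omega_1$ the subspace topology. For a topological space $X$ let $C_k(X)$ and $C_p(X)$ denote the set of all continuous functions $X \to \mathbb{R}$ with the compact-open topology and with the topology of pointwise convergence, respectively. There is a family $\mathcal{A}$ of subsets of $\omega_1$ with $|\mathcal{A}| = 2^{\omega_1}$ such that, for any two distinct $S, T \in \mathcal{A}$: (1) there is no continuous open surjection of $C_k(T)$ onto $C_k(S)$, and $C_k(S)$ is not homeomorphic to a subspace of $C_k(T)$; (2) there is no continuous linear surjection of $C_p(S)$ onto $C_p(T)$, and there is no linear topological embedding of $C_p(S)$ into $C_p(T)$ (that is, no linear map $C_p(S) \to C_p(T)$ which is a homeomorphism onto its image). -/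

import Mathlib

open scoped Ordinal Cardinal

/-- The space `ω₁` of all countable ordinals. Its topology, inherited from the order topology of
the ordinals, is the order topology. -/
abbrev OmegaOne : Type 1 := Set.Iio (ω₁ : Ordinal.{0})

/-- `C_k(X)`: the continuous real-valued functions on `X`, with the compact-open topology (this is
the topology that `C(X, ℝ)` carries). -/
abbrev Ck (X : Type*) [TopologicalSpace X] := C(X, ℝ)

/-- `C_p(X)`: the real vector space of continuous real-valued functions on `X`, with the topology
of pointwise convergence, that is, the subspace topology from the product `X → ℝ`. -/
abbrev Cp (X : Type*) [TopologicalSpace X] := continuousSubmodule X ℝ ℝ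

/-! Ulam's theorem gives `2 ^ ℵ₁` subsets of `ω₁` whose pairwise differences, in both directions,
are stationary; every nonexistence claim follows from this by pressing down. For `C_k`, an open
continuous map or an embedding carries neighbourhoods of one function monotonically and cofinally to
neighbourhoods of another. This assigns to each `s ∈ S` a compact `K s ⊆ T` and a natural number, so
that the `s` with `K s` inside a fixed compact set and with a fixed number lie in a compact subset
of `S`. If `s ∉ T`, then `K s` is bounded below `s`; pressing down yields points `s k` converging to
some `t ∈ T \ S` whose sets lie in one compact subset of `T`, although no compact subset of `S`
contains all `s k` (`exists_isCompact_of_isStationary_sdiff`). For `C_p`, continuous functionals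
have finite support, and for club many `t`, if `t ∈ T \ S`, the functional at `t` is supported
strictly below `t` (`exists_isClub_support_lt`). Pressing down these supports excludes surjections;
a similar argument on `S` excludes embeddings. -/

/-- A linear order that looks like `ω₁`: a well-order without maximum whose proper initial segments
are countable and in which countable sets are bounded. -/
class OmegaOneOrder (W : Type*) [LinearOrder W] : Prop extends
    WellFoundedLT W, NoMaxOrder W where
  nonempty : Nonempty W
  countable_Iic : ∀ a : W, (Set.Iic a).Countable
  bddAbove_of_countable : ∀ s : Set W, s.Countable → BddAbove s

/-! ### Clubs, stationary sets and pressing down. -/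

namespace OmegaOneOrder

open Set Order

variable {W : Type*} [LinearOrder W] [OmegaOneOrder W]

instance (priority := 100) : Nonempty W := nonempty

theorem countable_Iio (a : W) : (Iio a).Countable := (countable_Iic a).mono Iio_subset_Iic_self

theorem exists_gt_of_countable {s : Set W} (hs : s.Countable) : ∃ b, ∀ a ∈ s, a < b := by
  obtain ⟨b, hb⟩ := bddAbove_of_countable s hs
  obtain ⟨c, hc⟩ := exists_gt b
  exact ⟨c, fun a ha ↦ (hb ha).trans_lt hc⟩

theorem exists_isLUB {s : Set W} (hs : BddAbove s) : ∃ b, IsLUB s b :=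
  ⟨WellFounded.min wellFounded_lt (upperBounds s) hs, WellFounded.min_mem _ _ hs,
    fun _ hc ↦ not_lt.1 (WellFounded.not_lt_min wellFounded_lt (s := upperBounds s) hc)⟩

theorem exists_Iic_eq_Iio (a : W) : ∃ b, a < b ∧ Iic a = Iio b := by
  obtain ⟨b, hb⟩ := exists_gt a
  refine ⟨WellFounded.min wellFounded_lt (Ioi a) ⟨b, hb⟩, WellFounded.min_mem _ (Ioi a) _, ?_⟩
  ext x
  refine ⟨fun hx ↦ lt_of_le_of_lt hx (WellFounded.min_mem _ (Ioi a) _), fun hx ↦ not_lt.1 fun h ↦ ?_⟩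
  exact WellFounded.not_lt_min wellFounded_lt (s := Ioi a) h hx

/-- This is what makes clubs closed under countable intersections, and the nonstationary sets under
countable unions. -/
theorem cof_ne_aleph0 : Order.cof W ≠ ℵ₀ := by
  intro h
  obtain ⟨s, hs, hc⟩ := Order.exists_cof_eq W
  have : s.Countable := by
    rw [← Cardinal.le_aleph0_iff_set_countable, hc, h]
  obtain ⟨b, hb⟩ := exists_gt_of_countable this
  obtain ⟨c, hc, hbc⟩ := hs b
  exact (hb c hc).not_ge hbc

theorem isClub_Ioi (a : W) : IsClub (Ioi a) := by
  refine ⟨fun s hs ⟨x, hx⟩ _ b hb ↦ (hs hx).trans_le (hb.1 hx), fun x ↦ ?_⟩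
  obtain ⟨b, hb⟩ := exists_gt (max a x)
  exact ⟨b, (le_max_left _ _).trans_lt hb, ((le_max_right _ _).trans_lt hb).le⟩

/-- The diagonal intersection of clubs is a club. -/
theorem isClub_diagonal {C : W → Set W} (hC : ∀ i, IsClub (C i)) :
    IsClub {b | ∀ i < b, b ∈ C i} := by
  constructor
  · intro s hs _ _ a ha i hi
    obtain ⟨d, hd, hid⟩ := (lt_isLUB_iff ha).1 hi
    refine (hC i).isLUB_mem (t := s ∩ Ioi i) (fun x hx ↦ hs hx.1 i hx.2) ⟨d, hd, hid⟩ ⟨?_, ?_⟩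
    · exact fun x hx ↦ ha.1 hx.1
    · intro b hb
      refine ha.2 fun x hx ↦ ?_
      rcases lt_or_ge i x with h | h
      · exact hb ⟨hx, h⟩
      · exact h.trans (hid.le.trans (hb ⟨hd, hid⟩))
  · intro a
    have h1 : ∀ i x, ∃ y ∈ C i, x < y := fun i x ↦ by
      obtain ⟨z, hz⟩ := exists_gt x
      obtain ⟨y, hy, hzy⟩ := (hC i).isCofinal z
      exact ⟨y, hy, hz.trans_le hzy⟩
    choose nxt hnC hn using h1
    have h2 : ∀ x, ∃ y, ∀ i ≤ x, nxt i x < y := fun x ↦ by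
      obtain ⟨b, hb⟩ := exists_gt_of_countable ((countable_Iic x).image fun i ↦ nxt i x)
      exact ⟨b, fun i hi ↦ hb _ ⟨i, hi, rfl⟩⟩
    choose h hh using h2
    -- Closing off: `g (n + 1)` exceeds the chosen points of `C i` above `g n` for all `i ≤ g n`.
    -- For `i` below the supremum, these points interleave with `g`, so the supremum lies in `C i`.
    let g : ℕ → W := Nat.rec a fun _ x ↦ h x
    have hg : ∀ n, g (n + 1) = h (g n) := fun _ ↦ rfl
    have hmono : StrictMono g := strictMono_nat_of_lt_succ fun n ↦
      (hn (g n) (g n)).trans (hh (g n) _ le_rfl)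
    obtain ⟨b, hb⟩ := exists_isLUB (bddAbove_of_countable _ (countable_range g))
    refine ⟨b, fun i hi ↦ ?_, hb.1 ⟨0, rfl⟩⟩
    obtain ⟨_, ⟨n, rfl⟩, hin⟩ := (lt_isLUB_iff hb).1 hi
    refine (hC i).isLUB_mem (t := (fun m ↦ nxt i (g m)) '' Ici n) ?_ ⟨_, n, self_mem_Ici, rfl⟩ ⟨?_, ?_⟩
    · rintro _ ⟨m, _, rfl⟩
      exact hnC _ _
    · rintro _ ⟨m, hm, rfl⟩
      exact (hh (g m) i (hin.le.trans (hmono.monotone hm))).le.trans (hb.1 ⟨m + 1, rfl⟩)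
    · intro c hc
      refine hb.2 ?_
      rintro _ ⟨m, rfl⟩
      calc g m ≤ g (max m n) := hmono.monotone (le_max_left _ _)
        _ ≤ nxt i (g (max m n)) := (hn _ _).le
        _ ≤ c := hc ⟨_, mem_Ici.2 (le_max_right _ _), rfl⟩

/-- The points closed under a function form a club. -/
theorem isClub_closed_under (h : W → W) : IsClub {b | ∀ x < b, h x < b} :=
  isClub_diagonal fun x ↦ isClub_Ioi (h x)

/-- The limit points of an unbounded set form a club. -/
theorem isClub_limit_points {Z : Set W} (hZ : IsCofinal Z) :
    IsClub {b | ∀ x < b, ∃ z ∈ Z, x < z ∧ z < b} := by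
  refine isClub_diagonal (C := fun x ↦ {b | ∃ z ∈ Z, x < z ∧ z < b}) fun x ↦ ⟨?_, fun a ↦ ?_⟩
  · rintro s hs ⟨y, hy⟩ _ b hb
    obtain ⟨z, hz, hxz, hzy⟩ := hs hy
    exact ⟨z, hz, hxz, hzy.trans_le (hb.1 hy)⟩
  · obtain ⟨y, hy⟩ := exists_gt x
    obtain ⟨z, hz, hyz⟩ := hZ y
    obtain ⟨c, hc⟩ := exists_gt (max a z)
    exact ⟨c, ⟨z, hz, hy.trans_le hyz, (le_max_right _ _).trans_lt hc⟩,
      ((le_max_left _ _).trans_lt hc).le⟩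

theorem _root_.IsStationary.inter_isClub {Z C : Set W} (hZ : IsStationary Z) (hC : IsClub C) :
    IsStationary (Z ∩ C) := fun D hD ↦ by
  obtain ⟨x, hx, hxC, hxD⟩ := hZ (hC.inter cof_ne_aleph0 hD)
  exact ⟨x, ⟨hx, hxC⟩, hxD⟩

theorem _root_.IsStationary.exists_gt {Z : Set W} (hZ : IsStationary Z) (a : W) :
    ∃ z ∈ Z, a < z := hZ (isClub_Ioi a)

theorem _root_.IsStationary.isCofinal {Z : Set W} (hZ : IsStationary Z) : IsCofinal Z := fun a ↦
  let ⟨z, hz, h⟩ := hZ.exists_gt a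
  ⟨z, hz, h.le⟩

/-- Fodor's pressing down lemma. -/
theorem _root_.IsStationary.pressing_down {Z : Set W} (hZ : IsStationary Z) (f : W → W)
    (hf : ∀ s ∈ Z, f s < s) : ∃ a, IsStationary {s ∈ Z | f s = a} := by
  by_contra! h
  simp_rw [not_isStationary_iff] at h
  choose C hC hd using h
  obtain ⟨s, hs, hsC⟩ := hZ (isClub_diagonal hC)
  exact disjoint_left.1 (hd (f s)) ⟨hs, rfl⟩ (hsC _ (hf s hs))

theorem _root_.IsStationary.exists_fiber {ι : Type*} [Countable ι] {Z : Set W}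
    (hZ : IsStationary Z) (f : W → ι) : ∃ i, IsStationary {s ∈ Z | f s = i} := by
  rw [← isStationary_iUnion_iff_of_countable cof_ne_aleph0]
  exact hZ.mono fun s hs ↦ mem_iUnion.2 ⟨f s, hs, rfl⟩

end OmegaOneOrder

/-! ### Compact subsets of initial segments and the Tukey obstruction. -/

namespace OmegaOneOrder

open Set Order Topology Filter

/-- A closed set missing a non-minimal point `s` is bounded below `s` on the left of `s`. -/
theorem exists_bound_left {W : Type*} [LinearOrder W] [TopologicalSpace W] [OrderTopology W]
    {K : Set W} {s b : W} (hK : IsClosed K) (hs : s ∉ K) (hb : b < s) :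
    ∃ a < s, K ∩ Iio s ⊆ Iic a := by
  obtain ⟨l, hl, hlU⟩ := exists_Ioc_subset_of_mem_nhds (hK.isOpen_compl.mem_nhds hs) ⟨b, hb⟩
  refine ⟨l, hl, fun y hy ↦ not_lt.1 fun h ↦ hlU ⟨h, le_of_lt hy.2⟩ hy.1⟩

variable {W : Type*} [LinearOrder W] [OmegaOneOrder W] [TopologicalSpace W] [OrderTopology W]

theorem isClopen_Iic (a : W) : IsClopen (Iic a) := by
  refine ⟨isClosed_Iic, ?_⟩
  obtain ⟨b, -, hb⟩ := exists_Iic_eq_Iio a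
  exact hb ▸ isOpen_Iio

theorem isClopen_Ioi (a : W) : IsClopen (Ioi a) := by
  simpa using (isClopen_Iic a).compl

/-- A neighbourhood of a point contains an interval below it, whose end points generate a
neighbourhood. -/
theorem exists_Icc_subset {x : W} {U : Set W} (hU : U ∈ 𝓝 x) :
    ∃ a ≤ x, x ∈ interior (Icc a x) ∧ Icc a x ⊆ U := by
  by_cases h : ∃ l, l < x
  · obtain ⟨l, hl, hlU⟩ := exists_Ioc_subset_of_mem_nhds hU h
    obtain ⟨a, hla, ha⟩ := exists_Iic_eq_Iio l
    have hI : Icc a x = Ioc l x := by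
      ext y
      have : y ≤ l ↔ y < a := Set.ext_iff.1 ha y
      simp only [mem_Icc, mem_Ioc]
      grind
    refine ⟨a, ?_, ?_, hI ▸ hlU⟩
    · exact (hI.symm ▸ (⟨hl, le_rfl⟩ : x ∈ Ioc l x) : x ∈ Icc a x).1
    · exact mem_interior.2 ⟨Ioc l x, hI.ge, isOpen_Ioi.inter (isClopen_Iic x).isOpen, hl, le_rfl⟩
  · push Not at h
    refine ⟨x, le_rfl, ?_, by simpa using mem_of_mem_nhds hU⟩
    refine mem_interior.2 ⟨Iic x, fun y hy ↦ ⟨h y, hy⟩, (isClopen_Iic x).isOpen, le_rfl⟩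

/-- A finite subfamily covering `κ` already covers all but finitely many `K n`. -/
theorem isCompact_union_iUnion {X : Type*} [TopologicalSpace X] {κ : Set X} {K : ℕ → Set X}
    (hκ : IsCompact κ) (hK : ∀ n, IsCompact (K n))
    (h : ∀ U, IsOpen U → κ ⊆ U → ∀ᶠ n in atTop, K n ⊆ U) : IsCompact (κ ∪ ⋃ n, K n) := by
  refine isCompact_of_finite_subcover fun {ι} U hU hsub ↦ ?_
  obtain ⟨t, ht⟩ := hκ.elim_finite_subcover U hU (subset_union_left.trans hsub)
  obtain ⟨N, hN⟩ := eventually_atTop.1 (h _ (isOpen_biUnion fun i (_ : i ∈ t) ↦ hU i) ht)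
  have hc : IsCompact (⋃ n ∈ Finset.range N, K n) := (Finset.range N).isCompact_biUnion fun n _ ↦ hK n
  obtain ⟨t', ht'⟩ := hc.elim_finite_subcover U hU
    ((iUnion₂_subset fun n _ ↦ subset_iUnion K n).trans (subset_union_right.trans hsub))
  classical
  refine ⟨t ∪ t', union_subset (ht.trans ?_) (iUnion_subset fun n ↦ ?_)⟩
  · exact biUnion_subset_biUnion_left fun i hi ↦ Finset.mem_union_left _ hi
  · rcases lt_or_ge n N with hn | hn
    · refine (Subset.trans ?_ ht').trans
        (biUnion_subset_biUnion_left fun i hi ↦ Finset.mem_union_right _ hi)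
      exact subset_biUnion_of_mem (u := K) (Finset.mem_coe.2 (Finset.mem_range.2 hn))
    · exact (hN n hn).trans (biUnion_subset_biUnion_left fun i hi ↦ Finset.mem_union_left _ hi)

/-- There are countably many open sets that separate the compact subsets of an initial segment
from the complements of their neighbourhoods. -/
theorem exists_countable_opens (α : W) : ∃ O : ℕ → Set W, (∀ n, IsOpen (O n)) ∧
    ∀ κ ⊆ Iic α, IsCompact κ → ∀ U, IsOpen U → κ ⊆ U → ∃ n, κ ⊆ O n ∧ O n ⊆ U := by
  have := (countable_Iic α).to_subtype
  -- Finite unions of interval interiors with end points in the countable set `Iic α`: only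
  -- countably many, yet enough to separate compact sets.
  let B : Finset (Iic α × Iic α) → Set W := fun J ↦ ⋃ p ∈ J, interior (Icc (p.1 : W) p.2)
  have hne : Nonempty (Finset (Iic α × Iic α)) := ⟨∅⟩
  obtain ⟨e, he⟩ := exists_surjective_nat (Finset (Iic α × Iic α))
  refine ⟨B ∘ e, fun n ↦ isOpen_biUnion fun _ _ ↦ isOpen_interior, fun κ hα hκ U hU hκU ↦ ?_⟩
  let V : {p : Iic α × Iic α // Icc (p.1 : W) p.2 ⊆ U} → Set W := fun p ↦
    interior (Icc (p.1.1 : W) p.1.2)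
  obtain ⟨t, ht⟩ := hκ.elim_finite_subcover V (fun _ ↦ isOpen_interior) fun x hx ↦ by
    obtain ⟨a, hax, hx', haU⟩ := exists_Icc_subset (hU.mem_nhds (hκU hx))
    exact mem_iUnion.2 ⟨⟨(⟨a, hax.trans (hα hx)⟩, ⟨x, hα hx⟩), haU⟩, hx'⟩
  classical
  obtain ⟨n, hn⟩ := he (t.image Subtype.val)
  refine ⟨n, fun x hx ↦ ?_, fun x hx ↦ ?_⟩
  · obtain ⟨p, hp, hxp⟩ := mem_iUnion₂.1 (ht hx)
    simp only [Function.comp, hn, B]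
    exact mem_iUnion₂.2 ⟨p, Finset.mem_image_of_mem _ hp, hxp⟩
  · simp only [Function.comp, hn, B] at hx
    obtain ⟨p, hp, hxp⟩ := mem_iUnion₂.1 hx
    obtain ⟨q, -, rfl⟩ := Finset.mem_image.1 hp
    exact q.2 (interior_subset hxp)

/-- Among stationarily many compact subsets of an initial segment there is one that is, on a club
of places, a limit of the others in the upper Vietoris topology. -/
theorem exists_condensation {Z : Set W} (hZ : IsStationary Z) (κ : W → Set W) (α : W)
    (hκ : ∀ s ∈ Z, IsCompact (κ s) ∧ κ s ⊆ Iic α) :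
    ∃ z ∈ Z, ∃ C, IsClub C ∧ ∀ t ∈ C, ∀ U, IsOpen U → κ z ⊆ U → ∀ a < t,
      ∃ s ∈ Z, a < s ∧ s < t ∧ κ s ⊆ U := by
  obtain ⟨O, hO, hOκ⟩ := exists_countable_opens α
  let Y : ℕ → Set W := fun n ↦ {s ∈ Z | κ s ⊆ O n}
  have h1 : ∀ n, ∃ b, IsCofinal (Y n) ∨ ∀ s ∈ Y n, s < b := fun n ↦ by
    by_cases h : IsCofinal (Y n)
    · exact ⟨Classical.arbitrary W, .inl h⟩
    · obtain ⟨b, hb⟩ := not_isCofinal_iff.1 h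
      exact ⟨b, .inr fun s hs ↦ by simpa using hb s hs⟩
  choose b hb using h1
  -- A `z` beyond all bounds of the bounded `Y n` lies only in cofinal ones.
  obtain ⟨β, hβ⟩ := exists_gt_of_countable (countable_range b)
  obtain ⟨z, hz, hβz⟩ := hZ.exists_gt β
  refine ⟨z, hz, ⋂ n : {n // IsCofinal (Y n)}, {b | ∀ x < b, ∃ y ∈ Y n, x < y ∧ y < b},
    IsClub.iInter_of_countable cof_ne_aleph0 fun n ↦ isClub_limit_points n.2, ?_⟩
  intro t ht U hU hzU a ha
  obtain ⟨n, hn, hnU⟩ := hOκ _ (hκ z hz).2 (hκ z hz).1 U hU hzU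
  have hc : IsCofinal (Y n) := (hb n).resolve_right fun h ↦
    ((h z ⟨hz, hn⟩).trans (hβ _ ⟨n, rfl⟩)).not_gt hβz
  obtain ⟨s, hs, has, hst⟩ := mem_iInter.1 ht ⟨n, hc⟩ a ha
  exact ⟨s, hs.1, has, hst, hs.2.trans hnU⟩

/-- There is no Tukey map from the compact subsets of `S` to the compact subsets of `T` (times `ℕ`)
if both differences are stationary. -/
theorem exists_isCompact_of_isStationary_sdiff {S T : Set W} (hST : IsStationary (S \ T))
    (hTS : IsStationary (T \ S)) (K : W → Set W) (n : W → ℕ)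
    (hK : ∀ s ∈ S, IsCompact (K s) ∧ K s ⊆ T) :
    ∃ L ⊆ T, IsCompact L ∧ ∃ m, ∀ M ⊆ S, IsCompact M → ∃ s ∈ S, n s = m ∧ K s ⊆ L ∧ s ∉ M := by
  obtain ⟨m, hm⟩ := hST.exists_fiber n
  obtain ⟨b⟩ : Nonempty W := inferInstance
  have hf : ∀ s ∈ {s ∈ S \ T | n s = m} ∩ Ioi b, ∃ a < s, K s ∩ Iio s ⊆ Iic a := fun s hs ↦
    exists_bound_left (hK s hs.1.1.1).1.isClosed (fun h ↦ hs.1.1.2 ((hK s hs.1.1.1).2 h)) hs.2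
  choose! f hfs hfK using hf
  obtain ⟨α, hα⟩ := (hm.inter_isClub (isClub_Ioi b)).pressing_down f hfs
  set Z := {s ∈ {s ∈ S \ T | n s = m} ∩ Ioi b | f s = α} with hZdef
  have hZS : ∀ s ∈ Z, s ∈ S := fun s hs ↦ hs.1.1.1.1
  have hZK : ∀ s ∈ Z, K s ∩ Iio s ⊆ Iic α := fun s hs ↦ hs.2 ▸ hfK s hs.1
  obtain ⟨z, hz, C, hC, hCz⟩ := exists_condensation hα (fun s ↦ K s ∩ Iic α) α fun s hs ↦
    ⟨(hK s (hZS s hs)).1.inter_right isClosed_Iic, inter_subset_right⟩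
  have hbd : ∀ s, ∃ c, s ∈ S → K s ⊆ Iic c := fun s ↦ by
    by_cases hs : s ∈ S
    · obtain ⟨c, hc⟩ := (hK s hs).1.bddAbove
      exact ⟨c, fun _ x hx ↦ hc hx⟩
    · exact ⟨s, fun h ↦ (hs h).elim⟩
  choose c hc using hbd
  obtain ⟨t, ⟨htT, htS⟩, ⟨htC, htc⟩, hbt⟩ := hTS
    ((hC.inter cof_ne_aleph0 (isClub_closed_under c)).inter cof_ne_aleph0 (isClub_Ioi b))
  have hct := (countable_Iio t).to_subtype
  have hne : Nonempty (Iio t) := ⟨⟨b, hbt⟩⟩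
  obtain ⟨a, ha⟩ := exists_surjective_nat (Iio t)
  obtain ⟨O, hO, hOκ⟩ := exists_countable_opens α
  have hκz := hK z (hZS z hz)
  -- a sequence converging to `t` along which the compact sets converge
  have hseq : ∀ k : ℕ, ∃ s ∈ Z, (∀ i ≤ k, (a i : W) < s) ∧ s < t ∧
      ∀ i ≤ k, K z ∩ Iic α ⊆ O i → K s ∩ Iic α ⊆ O i := fun k ↦ by
    obtain ⟨i₀, -, hi₀⟩ := (Finset.range (k + 1)).exists_max_image (fun i ↦ (a i : W)) ⟨0, by simp⟩
    obtain ⟨s, hs, has, hst, hsU⟩ := hCz t htC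
      (⋂ i ∈ {i | i ≤ k ∧ K z ∩ Iic α ⊆ O i}, O i)
      (((finite_Iic k).subset fun i hi ↦ hi.1).isOpen_biInter fun i _ ↦ hO i)
      (subset_iInter₂ fun i hi ↦ hi.2) (a i₀) (a i₀).2
    exact ⟨s, hs, fun i hi ↦ (hi₀ i (Finset.mem_range_succ_iff.2 hi)).trans_lt has, hst,
      fun i hi hzi ↦ hsU.trans (biInter_subset_of_mem ⟨hi, hzi⟩)⟩
  choose s hsZ hsa hst hsO using hseq
  have hlim : ∀ x < t, ∀ᶠ k in atTop, x < s k := fun x hx ↦ by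
    obtain ⟨i, hi⟩ := ha ⟨x, hx⟩
    filter_upwards [eventually_ge_atTop i] with k hk
    simpa [hi] using hsa k i hk
  -- Below `s k` the set `K (s k)` lies in `Iic α`, where it approaches `K z ∩ Iic α`; its remaining
  -- points lie between `s k` and `t`, hence tend to `t`.
  refine ⟨((K z ∩ Iic α) ∪ {t}) ∪ ⋃ k, K (s k), ?_, ?_, m, fun M hMS hM ↦ ?_⟩
  · refine union_subset (union_subset (inter_subset_left.trans hκz.2) (by simpa using htT)) ?_
    exact iUnion_subset fun k ↦ (hK _ (hZS _ (hsZ k))).2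
  · refine isCompact_union_iUnion ((hκz.1.inter_right isClosed_Iic).union isCompact_singleton)
      (fun k ↦ (hK _ (hZS _ (hsZ k))).1) fun U hU hsub ↦ ?_
    obtain ⟨i, hi, hiU⟩ := hOκ _ inter_subset_right (hκz.1.inter_right isClosed_Iic) U hU
      (subset_union_left.trans hsub)
    obtain ⟨l, hl, hlU⟩ := exists_Ioc_subset_of_mem_nhds (hU.mem_nhds (hsub (.inr rfl))) ⟨b, hbt⟩
    filter_upwards [hlim l hl, eventually_ge_atTop i] with k hk hik x hx
    rcases lt_or_ge x (s k) with h | h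
    · exact hiU (hsO k i hik hi ⟨hx, hZK _ (hsZ k) ⟨hx, h⟩⟩)
    · exact hlU ⟨hk.trans_le h, (hc _ (hZS _ (hsZ k)) hx).trans (htc _ (hst k)).le⟩
  · by_contra! hcon
    have hsM : ∀ k, s k ∈ M := fun k ↦ hcon _ (hZS _ (hsZ k)) (hsZ k).1.1.2
      ((subset_iUnion (fun k ↦ K (s k)) k).trans subset_union_right)
    have htend : Tendsto s atTop (𝓝 t) := tendsto_order.2
      ⟨hlim, fun x hx ↦ Eventually.of_forall fun k ↦ (hst k).trans hx⟩
    exact htS (hMS (hM.isClosed.mem_of_tendsto htend (Eventually.of_forall hsM)))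

end OmegaOneOrder

open Set Topology Filter

/-! ### Neighbourhoods in the compact-open topology. -/

namespace ContinuousMap

variable {X : Type*} [TopologicalSpace X]

theorem hasBasis_nhds_abs_sub_lt (p : C(X, ℝ)) :
    (𝓝 p).HasBasis (fun Kn : Set X × ℕ ↦ IsCompact Kn.1)
      fun Kn ↦ {g | ∀ x ∈ Kn.1, |g x - p x| < 1 / (Kn.2 + 1)} := by
  have := nhds_basis_uniformity' (Metric.uniformity_basis_dist_inv_nat_succ
    (α := ℝ)).compactConvergenceUniformity (x := p)
  simpa [UniformSpace.ball, Real.dist_eq, abs_sub_comm] using this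

theorem exists_eq_on_isCompact_ne [T35Space X] {L : Set X} (hL : IsCompact L) {s : X} (hs : s ∉ L)
    (p : C(X, ℝ)) : ∃ g : C(X, ℝ), (∀ x ∈ L, g x = p x) ∧ |g s - p s| = 1 := by
  obtain ⟨f, hf, hfs, hfL⟩ := CompletelyRegularSpace.completely_regular s L hL.isClosed hs
  refine ⟨p + (1 - ⟨fun x ↦ (f x : ℝ), by fun_prop⟩), fun x hx ↦ ?_, ?_⟩
  · simp [hfL hx]
  · simp [hfs]

/-- A monotone map between the neighbourhood filters of `C_k(X)` and `C_k(Y)` with cofinal image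
gives a Tukey map from the compact subsets of `Y` to the compact subsets of `X`. -/
theorem exists_tukey_map {Y : Type*} [TopologicalSpace Y] [T35Space Y] {p : C(X, ℝ)} {q : C(Y, ℝ)}
    {Φ : Set C(X, ℝ) → Set C(Y, ℝ)} (hΦ : Monotone Φ) (hΦn : ∀ U ∈ 𝓝 p, Φ U ∈ 𝓝 q)
    (hΦc : ∀ V ∈ 𝓝 q, ∃ U ∈ 𝓝 p, Φ U ⊆ V) :
    ∃ (K : Y → Set X) (n : Y → ℕ), (∀ y, IsCompact (K y)) ∧
      ∀ L m, IsCompact L → ∃ M, IsCompact M ∧ ∀ y, n y = m → K y ⊆ L → y ∈ M := by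
  have h : ∀ y : Y, ∃ Kn : Set X × ℕ, IsCompact Kn.1 ∧
      Φ {g | ∀ x ∈ Kn.1, |g x - p x| < 1 / (Kn.2 + 1)} ⊆ {g | |g y - q y| < 1} := fun y ↦ by
    obtain ⟨U, hU, hUV⟩ := hΦc {g | |g y - q y| < 1} <|
      (isOpen_lt (by fun_prop) continuous_const).mem_nhds (by simp)
    obtain ⟨Kn, hK, hKU⟩ := (hasBasis_nhds_abs_sub_lt p).mem_iff.1 hU
    exact ⟨Kn, hK, (hΦ hKU).trans hUV⟩
  choose Kn hK hKn using h
  refine ⟨fun y ↦ (Kn y).1, fun y ↦ (Kn y).2, hK, fun L m hL ↦ ?_⟩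
  obtain ⟨⟨M, k⟩, hM, hMΦ⟩ := (hasBasis_nhds_abs_sub_lt q).mem_iff.1 <|
    hΦn _ ((hasBasis_nhds_abs_sub_lt p).mem_of_mem (i := (L, m)) hL)
  refine ⟨M, hM, fun y hy hyL ↦ by_contra fun hyM ↦ ?_⟩
  -- Outside `M` the value at `y` is unconstrained, so `g` can violate the bound `1` that `K y ⊆ L`
  -- would force.
  obtain ⟨g, hgM, hgy⟩ := exists_eq_on_isCompact_ne hM hyM q
  have hg : g ∈ Φ {g | ∀ x ∈ L, |g x - p x| < 1 / ((m : ℝ) + 1)} := hMΦ fun x hx ↦ by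
    simp only [hgM x hx, sub_self, abs_zero]
    positivity
  refine (hKn y (hΦ ?_ hg)).ne hgy
  intro f hf x hx
  have hy : (Kn y).2 = m := hy
  rw [hy]
  exact hf x (hyL hx)

end ContinuousMap

namespace OmegaOneOrder

open ContinuousMap

variable {W : Type*} [LinearOrder W] [OmegaOneOrder W] [TopologicalSpace W] [OrderTopology W]
  {S T : Set W}

theorem not_exists_tukey_map (hST : IsStationary (S \ T)) (hTS : IsStationary (T \ S))
    {p : C(T, ℝ)} {q : C(S, ℝ)} {Φ : Set C(T, ℝ) → Set C(S, ℝ)} (hΦ : Monotone Φ)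
    (hΦn : ∀ U ∈ 𝓝 p, Φ U ∈ 𝓝 q) (hΦc : ∀ V ∈ 𝓝 q, ∃ U ∈ 𝓝 p, Φ U ⊆ V) : False := by
  obtain ⟨K, n, hK, hKn⟩ := exists_tukey_map hΦ hΦn hΦc
  classical
  let K' : W → Set W := fun s ↦ if h : s ∈ S then (↑) '' K ⟨s, h⟩ else ∅
  let n' : W → ℕ := fun s ↦ if h : s ∈ S then n ⟨s, h⟩ else 0
  have hK' : ∀ s : S, K' s = (↑) '' K s := fun s ↦ by simp [K']
  have hn' : ∀ s : S, n' s = n s := fun s ↦ by simp [n']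
  obtain ⟨L, hLT, hL, m, h⟩ := exists_isCompact_of_isStationary_sdiff hST hTS K' n' fun s hs ↦ by
    rw [hK' ⟨s, hs⟩]
    exact ⟨(hK _).image continuous_subtype_val, by simp⟩
  have hL' : IsCompact ((↑) ⁻¹' L : Set T) := by
    rw [Subtype.isCompact_iff, Subtype.image_preimage_coe, inter_eq_right.2 hLT]
    exact hL
  obtain ⟨M, hM, hMs⟩ := hKn _ m hL'
  obtain ⟨s, hs, hns, hsL, hsM⟩ := h ((↑) '' M) (by simp) (hM.image continuous_subtype_val)
  rw [hK' ⟨s, hs⟩] at hsL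
  rw [hn' ⟨s, hs⟩] at hns
  exact hsM ⟨⟨s, hs⟩, hMs _ hns (image_subset_iff.1 hsL), rfl⟩

theorem not_exists_isOpenMap (hST : IsStationary (S \ T)) (hTS : IsStationary (T \ S)) :
    ¬ ∃ f : C(T, ℝ) → C(S, ℝ), Continuous f ∧ IsOpenMap f := by
  rintro ⟨f, hf, hfo⟩
  refine not_exists_tukey_map hST hTS (p := 0) (q := f 0) (Φ := image f) monotone_image
    (fun U hU ↦ hfo.image_mem_nhds hU) fun V hV ↦ ?_
  exact ⟨f ⁻¹' V, hf.continuousAt hV, image_preimage_subset _ _⟩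

theorem not_exists_isEmbedding (hST : IsStationary (S \ T)) (hTS : IsStationary (T \ S)) :
    ¬ ∃ e : C(S, ℝ) → C(T, ℝ), IsEmbedding e := by
  rintro ⟨e, he⟩
  refine not_exists_tukey_map hST hTS (p := e 0) (q := 0) (Φ := preimage e) monotone_preimage
    (fun U hU ↦ he.continuous.continuousAt hU) fun V hV ↦ ?_
  rw [he.isInducing.nhds_eq_comap] at hV
  exact hV

end OmegaOneOrder

/-! ### Finite supports of functionals on `C_p`. -/

namespace Cp

variable {X Y : Type*} [TopologicalSpace X] [TopologicalSpace Y]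

theorem exists_finset_of_mem_nhds_zero {U : Set (Cp X)} (hU : U ∈ 𝓝 0) :
    ∃ F : Finset X, ∃ n : ℕ, ∀ f : Cp X, (∀ x ∈ F, |(f : X → ℝ) x| < 1 / (n + 1)) → f ∈ U := by
  rw [nhds_subtype_eq_comap, nhds_pi] at hU
  obtain ⟨⟨I, k⟩, ⟨hI, -⟩, hk⟩ := ((hasBasis_pi fun x : X ↦
    (Metric.nhds_basis_ball_inv_nat_succ (x := (0 : ℝ)))).comap
      ((↑) : Cp X → X → ℝ)).mem_iff.1 hU
  obtain ⟨n, hn⟩ := (hI.image k).bddAbove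
  refine ⟨hI.toFinset, n, fun f hf ↦ hk fun x hx ↦ ?_⟩
  have h1 : |(f : X → ℝ) x| < 1 / ((n : ℝ) + 1) := hf x (hI.mem_toFinset.2 hx)
  have h2 : (1 : ℝ) / (n + 1) ≤ 1 / (k x + 1) :=
    Nat.one_div_le_one_div (hn ⟨x, hx, rfl⟩)
  simpa [Real.dist_eq] using h1.trans_le h2

/-- A continuous linear functional on `C_p(X)` depends on finitely many values only. -/
theorem exists_finset_support (φ : Cp X →L[ℝ] ℝ) :
    ∃ F : Finset X, ∀ f : Cp X, (∀ x ∈ F, (f : X → ℝ) x = 0) → φ f = 0 := by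
  obtain ⟨F, n, hF⟩ := exists_finset_of_mem_nhds_zero
    ((isOpen_lt (by fun_prop) continuous_const).mem_nhds (by simp) : {f | |φ f| < 1} ∈ 𝓝 0)
  refine ⟨F, fun f hf ↦ by_contra fun h ↦ ?_⟩
  -- Rescaling keeps the zeros on `F` but makes the value of `φ` equal to `1`.
  have : |φ ((φ f)⁻¹ • f)| < 1 := hF _ fun x hx ↦ by
    simp only [Submodule.coe_smul, Pi.smul_apply, hf x hx, smul_zero, abs_zero]
    positivity
  simp [h] at this

/-- Evaluation at a point. -/
def eval (x : X) : Cp X →L[ℝ] ℝ := (ContinuousLinearMap.proj x).comp (Submodule.subtypeL _)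

@[simp]
theorem eval_apply (x : X) (f : Cp X) : eval x f = (f : X → ℝ) x := rfl

/-- Multiplication by the characteristic function of a clopen set. -/
noncomputable def indicator {C : Set X} (hC : IsClopen C) (f : Cp X) : Cp X :=
  ⟨C.indicator f, f.2.indicator (by simp [hC.frontier_eq])⟩

@[simp]
theorem coe_indicator {C : Set X} (hC : IsClopen C) (f : Cp X) :
    (indicator hC f : X → ℝ) = C.indicator f := rfl

/-- A functional supported on both `F` and `C` is supported on `F ∩ C`: split `f` along the clopen
set `C`. -/
theorem eq_zero_of_support_inter {φ : Cp X →L[ℝ] ℝ} {F : Finset X}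
    (hF : ∀ f : Cp X, (∀ x ∈ F, (f : X → ℝ) x = 0) → φ f = 0) {C : Set X} (hC : IsClopen C)
    (hφC : ∀ f : Cp X, (∀ x ∈ C, (f : X → ℝ) x = 0) → φ f = 0) {f : Cp X}
    (hf : ∀ x ∈ F, x ∈ C → (f : X → ℝ) x = 0) : φ f = 0 := by
  have h1 : φ (indicator hC f) = 0 := hF _ fun x hx ↦ by
    by_cases h : x ∈ C <;> simp [h, hf x hx]
  have h2 : φ (f - indicator hC f) = 0 := hφC _ fun x hx ↦ by simp [hx]
  rw [map_sub, h1, sub_zero] at h2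
  exact h2

/-- A linear surjection cannot depend on too few values on a finite set. -/
theorem card_le_of_surjective [T35Space Y] {u : Cp X →ₗ[ℝ] Cp Y} (hu : Function.Surjective u)
    {F : Finset X} {P : Finset Y}
    (h : ∀ y ∈ P, ∀ f : Cp X, (∀ x ∈ F, (f : X → ℝ) x = 0) → (u f : Y → ℝ) y = 0) :
    P.card ≤ F.card := by
  classical
  have h1 : ∀ y : P, ∃ f : Cp X, (∀ z ∈ P, z ≠ y → (u f : Y → ℝ) z = 0) ∧ (u f : Y → ℝ) y ≠ 0 := by
    intro y
    obtain ⟨g, hg, hgy⟩ := ContinuousMap.exists_eq_on_isCompact_ne (L := ↑(P.erase y))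
      (Finset.finite_toSet _).isCompact (s := (y : Y)) (by simp) 0
    obtain ⟨f, hf⟩ := hu ⟨g, g.continuous⟩
    refine ⟨f, fun z hz hzy ↦ ?_, fun h0 ↦ ?_⟩
    · simpa [hf] using hg z (by simp [hz, hzy])
    · have : g y = 0 := by simpa [hf] using h0
      simp [this] at hgy
  choose f hf0 hf1 using h1
  by_contra! hcard
  -- With more functions than points of `F`, some nontrivial combination vanishes on `F`. Its image
  -- then vanishes on `P`, although the images of the `f y` are independent there.
  have hdep : ¬ LinearIndependent ℝ fun (y : P) (x : F) ↦ (f y : X → ℝ) x := fun hli ↦ by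
    have := hli.fintype_card_le_finrank
    simp only [Fintype.card_coe, Module.finrank_fintype_fun_eq_card] at this
    omega
  obtain ⟨c, hc, y, hy⟩ := Fintype.not_linearIndependent_iff.1 hdep
  have h2 := h y y.2 (∑ z, c z • f z) fun x hx ↦ by
    simpa using congrFun hc ⟨x, hx⟩
  have h3 : ∑ z, c z * (u (f z) : Y → ℝ) y = 0 := by simpa using h2
  rw [Finset.sum_eq_single y (fun z _ hz ↦ by
    rw [hf0 z y y.2 fun h ↦ hz (Subtype.ext h.symm), mul_zero]) (by simp)] at h3
  exact (mul_ne_zero hy (hf1 y)) h3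

end Cp

/-! ### Linear maps between `C_p(S)` and `C_p(T)`. -/

namespace OmegaOneOrder

variable {W : Type*} {S T : Set W}

theorem exists_abs_sub_lt_of_lt [LinearOrder W] [TopologicalSpace W] [OrderTopology W] {h : T → ℝ} (hh : Continuous h) {t : T} {b : W} (hb : b < t)
    {δ : ℝ} (hδ : 0 < δ) : ∃ l < (t : W), ∀ t' : T, l < t' → t' ≤ t → |h t' - h t| < δ := by
  have := hh.continuousAt.preimage_mem_nhds (Metric.ball_mem_nhds (h t) hδ)
  obtain ⟨U, hU, hUs⟩ := mem_nhds_subtype _ _ _ |>.1 this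
  obtain ⟨l, hl, hlU⟩ := exists_Ioc_subset_of_mem_nhds hU ⟨b, hb⟩
  exact ⟨l, hl, fun t' h1 h2 ↦ by simpa [Real.dist_eq] using hUs (hlU ⟨h1, h2⟩ : (t' : W) ∈ U)⟩

theorem exists_bound_of_finset [LinearOrder W] [OmegaOneOrder W] (F : W → Finset S) : ∃ g : W → W, ∀ t, ∀ x ∈ F t, (x : W) < g t := by
  have h : ∀ t, ∃ b, ∀ x ∈ F t, (x : W) < b := fun t ↦ by
    obtain ⟨b, hb⟩ := exists_gt_of_countable ((F t).finite_toSet.image ((↑) : S → W)).countable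
    exact ⟨b, fun x hx ↦ hb _ ⟨x, hx, rfl⟩⟩
  choose g hg using h
  exact ⟨g, hg⟩

theorem exists_bound_left_finset [LinearOrder W] [TopologicalSpace W] [OrderTopology W] (F : Finset S) {s b : W} (hb : b < s) :
    ∃ a < s, ∀ x ∈ F, (x : W) < s → x ≤ a := by
  obtain ⟨a, ha, h⟩ := exists_bound_left (K := ((↑) '' (F : Set S)) \ {s})
    ((F.finite_toSet.image _).subset sdiff_subset).isClosed (by simp) hb
  exact ⟨a, ha, fun x hx hxs ↦ h ⟨⟨⟨x, hx, rfl⟩, hxs.ne⟩, hxs⟩⟩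

theorem exists_support [TopologicalSpace W] (u : Cp S →L[ℝ] Cp T) : ∃ F : W → Finset S, ∀ t : T, ∀ f : Cp S,
    (∀ x ∈ F t, (f : S → ℝ) x = 0) → (u f : T → ℝ) t = 0 := by
  classical
  choose F hF using fun t : T ↦ Cp.exists_finset_support ((Cp.eval t).comp u)
  exact ⟨fun t ↦ if h : t ∈ T then F ⟨t, h⟩ else ∅, fun t f hf ↦ hF t f (by simpa using hf)⟩

variable [LinearOrder W] [OmegaOneOrder W] [TopologicalSpace W] [OrderTopology W]

/-- Club many points of `T` outside `S` are sent by the adjoint of a continuous linear map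
`C_p(S) → C_p(T)` to functionals supported strictly below them. -/
theorem exists_isClub_support_lt (hT : IsStationary T) (u : Cp S →L[ℝ] Cp T) :
    ∃ C, IsClub C ∧ ∀ t ∈ C, ∃ G : Finset S, (∀ x ∈ G, (x : W) < t) ∧ ∀ ht : t ∈ T, t ∉ S →
      ∀ f : Cp S, (∀ x ∈ G, (f : S → ℝ) x = 0) → (u f : T → ℝ) ⟨t, ht⟩ = 0 := by
  classical
  obtain ⟨F, hF⟩ := exists_support u
  obtain ⟨g, hg⟩ := exists_bound_of_finset F
  obtain ⟨b⟩ : Nonempty W := inferInstance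
  refine ⟨_, ((isClub_closed_under g).inter cof_ne_aleph0
    (isClub_limit_points hT.isCofinal)).inter cof_ne_aleph0 (isClub_Ioi b), ?_⟩
  rintro t ⟨⟨htg, htT⟩, hbt⟩
  refine ⟨{x ∈ F t | (x : W) < t}, fun x hx ↦ (Finset.mem_filter.1 hx).2, fun ht htS f hf ↦ ?_⟩
  have hC : IsClopen ((↑) ⁻¹' Iic t : Set S) := (isClopen_Iic t).preimage continuous_subtype_val
  refine Cp.eq_zero_of_support_inter (φ := (Cp.eval ⟨t, ht⟩).comp u) (hF ⟨t, ht⟩) hC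
    (fun f hf ↦ by_contra fun h0 ↦ ?_) fun x hx hxt ↦ hf x ?_
  -- If `f` vanishes on `S` up to `t`, then `u f` vanishes at the points of `T` below `t`, whose
  -- supports lie below `t`; these points accumulate at `t`, so continuity gives `u f t = 0`.
  · obtain ⟨l, hl, h⟩ := exists_abs_sub_lt_of_lt (u f).2 (t := ⟨t, ht⟩) hbt (abs_pos.2 h0)
    obtain ⟨t', ht', hlt, htt⟩ := htT l hl
    refine (h ⟨t', ht'⟩ hlt htt.le).ne ?_
    rw [hF ⟨t', ht'⟩ f fun x hx ↦ hf x ((hg _ x hx).trans (htg t' htt)).le]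
    simp
  · exact Finset.mem_filter.2 ⟨hx, lt_of_le_of_ne hxt fun h ↦ htS (h ▸ x.2)⟩

/-- Pressing down bounds the supports by one `α`; as `Iic α` has only countably many finite subsets,
infinitely many points of `T` share one finite support, too small for a surjection. -/
theorem not_surjective_of_isStationary_sdiff (hTS : IsStationary (T \ S)) (u : Cp S →L[ℝ] Cp T) :
    ¬ Function.Surjective u := by
  classical
  intro hu
  obtain ⟨C, hC, h⟩ := exists_isClub_support_lt (hTS.mono sdiff_subset) u
  choose! G hGt hGu using h
  obtain ⟨b⟩ : Nonempty W := inferInstance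
  have hf : ∀ t ∈ (T \ S) ∩ C ∩ Ioi b, ∃ a < t, ∀ x ∈ G t, (x : W) ≤ a := fun t ht ↦ by
    obtain ⟨a, ha, hx⟩ := exists_bound_left_finset (G t) ht.2
    exact ⟨a, ha, fun x hxt ↦ hx x hxt (hGt t ht.1.2 x hxt)⟩
  choose! f hft hfG using hf
  obtain ⟨α, hα⟩ := ((hTS.inter_isClub hC).inter_isClub (isClub_Ioi b)).pressing_down f hft
  have hcα := (countable_Iic α).to_subtype
  obtain ⟨J, hJ⟩ := hα.exists_fiber fun t ↦
    ((G t).map (Function.Embedding.subtype _)).subtype (· ∈ Iic α)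
  set Z := {t ∈ {t ∈ (T \ S) ∩ C ∩ Ioi b | f t = α} |
    ((G t).map (Function.Embedding.subtype _)).subtype (· ∈ Iic α) = J} with hZ
  have hmem : ∀ t ∈ Z, ∀ x : S, x ∈ G t ↔ ∃ y ∈ J, (y : W) = x := fun t ht x ↦ by
    rw [← ht.2]
    constructor
    · intro hx
      refine ⟨⟨x, ?_⟩, ?_, rfl⟩
      · exact (hfG t ht.1.1 x hx).trans ht.1.2.le
      · simpa using hx
    · rintro ⟨y, hy, hyx⟩
      simpa [hyx] using hy
  obtain ⟨t₀, ht₀⟩ := hJ.nonempty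
  have hinf : ((↑) ⁻¹' Z : Set T).Infinite := by
    intro hfin
    have hZc : Z.Countable := (hfin.image ((↑) : T → W)).countable.mono <| by
      intro t ht
      exact ⟨⟨t, ht.1.1.1.1.1⟩, ht, rfl⟩
    obtain ⟨c, hc⟩ := exists_gt_of_countable hZc
    obtain ⟨z, hz, hcz⟩ := hJ.exists_gt c
    exact (hc z hz).not_gt hcz
  obtain ⟨P, hPZ, hP⟩ := hinf.exists_subset_card_eq ((G t₀).card + 1)
  have := Cp.card_le_of_surjective (u := u.toLinearMap) hu (F := G t₀) (P := P) fun t ht f hf ↦ by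
    have htZ : (t : W) ∈ Z := hPZ ht
    refine hGu t htZ.1.1.1.2 t.2 htZ.1.1.1.1.2 f fun x hx ↦ hf x ?_
    rwa [hmem t₀ ht₀, ← hmem t htZ]
  omega

/-- Smallness of `e f` on a finite set `G s` controls `f s`. For stationarily many `s`, the part of
`G s` below `s` lies under a fixed `α₀`. Near a suitable `t ∈ T \ S`, the image of the indicator of
a final segment is zero on that part and small on the rest, yet the indicator is `1` at `s`. -/
theorem not_isEmbedding_of_isStationary_sdiff (hS : IsStationary S) (hTS : IsStationary (T \ S))
    (e : Cp S →L[ℝ] Cp T) : ¬ IsEmbedding e := by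
  classical
  intro he
  have h : ∀ s : W, ∃ (G : Finset T) (n : ℕ), ∀ hs : s ∈ S, ∀ f : Cp S,
      (∀ t ∈ G, |(e f : T → ℝ) t| < 1 / (n + 1)) → |(f : S → ℝ) ⟨s, hs⟩| < 1 := fun s ↦ by
    by_cases hs : s ∈ S
    · have hU : {f : Cp S | |Cp.eval ⟨s, hs⟩ f| < 1} ∈ 𝓝 0 :=
        (isOpen_lt (by fun_prop) continuous_const).mem_nhds (by simp)
      rw [he.isInducing.nhds_eq_comap, map_zero] at hU
      obtain ⟨V, hV, hVU⟩ := hU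
      obtain ⟨G, n, hG⟩ := Cp.exists_finset_of_mem_nhds_zero hV
      exact ⟨G, n, fun _ f hf ↦ hVU (hG _ hf)⟩
    · exact ⟨∅, 0, fun h ↦ (hs h).elim⟩
  choose G n hG using h
  obtain ⟨b⟩ : Nonempty W := inferInstance
  obtain ⟨m, hm⟩ := (hS.inter_isClub (isClub_Ioi b)).exists_fiber n
  have hf : ∀ s ∈ {s ∈ S ∩ Ioi b | n s = m}, ∃ a < s, ∀ x ∈ G s, (x : W) < s → x ≤ a :=
    fun s hs ↦ exists_bound_left_finset (G s) hs.1.2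
  choose! f hfs hfG using hf
  obtain ⟨α₀, hα₀⟩ := hm.pressing_down f hfs
  set Z := {s ∈ {s ∈ S ∩ Ioi b | n s = m} | f s = α₀} with hZ
  obtain ⟨F, hF⟩ := exists_support e
  obtain ⟨α, hα⟩ := exists_gt_of_countable <| (countable_Iic α₀).biUnion fun t _ ↦
    ((F t).finite_toSet.image ((↑) : S → W)).countable
  obtain ⟨C, hC, hCe⟩ := exists_isClub_support_lt (hTS.mono sdiff_subset) e
  obtain ⟨g, hg⟩ := exists_bound_of_finset G
  obtain ⟨t, ⟨htT, htS⟩, ⟨⟨htC, htg⟩, htZ⟩, hαt⟩ := hTS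
    (((hC.inter cof_ne_aleph0 (isClub_closed_under g)).inter cof_ne_aleph0
      (isClub_limit_points hα₀.isCofinal)).inter cof_ne_aleph0 (isClub_Ioi α))
  obtain ⟨G', hG't, hG'⟩ := hCe t htC
  obtain ⟨β₀, hβ₀, hGβ⟩ := exists_bound_left_finset G' hαt
  set β := max α β₀ with hβ
  have hβt : β < t := max_lt hαt hβ₀
  -- the characteristic function of the final segment above `β`
  let χ : Cp S := Cp.indicator (C := ((↑) ⁻¹' Ioi β : Set S))
    ((isClopen_Ioi β).preimage continuous_subtype_val) ⟨1, continuous_one⟩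
  have hχ0 : ∀ x : S, (x : W) ≤ β → (χ : S → ℝ) x = 0 := fun x hx ↦ by
    simp [χ, hx]
  have hχ1 : ∀ x : S, β < x → (χ : S → ℝ) x = 1 := fun x hx ↦ by
    simp [χ, hx]
  have het : (e χ : T → ℝ) ⟨t, htT⟩ = 0 := hG' htT htS χ fun x hx ↦
    hχ0 x ((hGβ x hx (hG't x hx)).trans (le_max_right _ _))
  obtain ⟨l, hl, hlt⟩ := exists_abs_sub_lt_of_lt (e χ).2 (t := ⟨t, htT⟩) hαt
    (by positivity : (0 : ℝ) < 1 / (m + 1))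
  obtain ⟨s, hsZ, hls, hst⟩ := htZ (max l β) (max_lt hl hβt)
  have hs1 : |(χ : S → ℝ) ⟨s, hsZ.1.1.1⟩| < 1 := hG s hsZ.1.1.1 χ fun t' ht' ↦ by
    rw [show n s = m from hsZ.1.2]
    rcases lt_or_ge (t' : W) s with h | h
    · have h1 : (t' : W) ≤ α₀ := (hfG s hsZ.1 t' ht' h).trans hsZ.2.le
      rw [hF t' χ fun x hx ↦ hχ0 x ?_, abs_zero]
      · positivity
      · exact (hα x (mem_iUnion₂.2 ⟨t', h1, x, hx, rfl⟩)).le.trans (le_max_left _ _)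
    · have := hlt t' (((le_max_left _ _).trans_lt hls).trans_le h)
        (((hg s t' ht').trans (htg s hst)).le)
      rwa [het, sub_zero] at this
  rw [hχ1 ⟨s, hsZ.1.1.1⟩ ((le_max_right _ _).trans_lt hls)] at hs1
  simp at hs1

end OmegaOneOrder

/-! ### Many sets with stationary differences. -/

namespace OmegaOneOrder

variable {W : Type*} [LinearOrder W] [OmegaOneOrder W]

/-- Ulam's theorem: there are `ℵ₁` disjoint stationary sets. -/
theorem exists_pairwise_disjoint_isStationary (hW : #W = ℵ₁) :
    ∃ Z : W × Bool → Set W, (∀ p, IsStationary (Z p)) ∧ Pairwise fun p q ↦ Disjoint (Z p) (Z q) := by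
  -- Ulam matrix: `f a` injects the predecessors of `a` into `ℕ`, so for a fixed value `m` the sets
  -- of all `a > b` with `f a b = m`, for distinct `b`, are disjoint.
  choose f hf using fun a : W ↦ countable_iff_exists_injOn.1 (countable_Iio a)
  choose n hn using fun b : W ↦ ((isClub_Ioi b).isStationary cof_ne_aleph0).exists_fiber (f · b)
  obtain ⟨m, hm⟩ := (IsStationary.univ (α := W)).exists_fiber n
  have hcard : #(W × Bool) ≤ #{b ∈ univ | n b = m} := by
    have h1 : #(W × Bool) = ℵ₁ := by
      rw [Cardinal.mk_prod, Cardinal.lift_id', hW]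
      simpa using Cardinal.mul_eq_left (Cardinal.aleph0_le_aleph 1)
        ((Cardinal.natCast_lt_aleph0 (n := 2)).le.trans (Cardinal.aleph0_le_aleph 1)) (by simp)
    rw [h1, ← Cardinal.succ_aleph0, Order.succ_le_iff, ← not_le,
      Cardinal.le_aleph0_iff_set_countable]
    intro hc
    obtain ⟨c, hc⟩ := exists_gt_of_countable hc
    obtain ⟨z, hz, hcz⟩ := hm.exists_gt c
    exact (hc z hz).not_gt hcz
  obtain ⟨j⟩ := Cardinal.le_def _ _ |>.1 hcard
  refine ⟨fun p ↦ {a ∈ Ioi (j p : W) | f a (j p) = m}, fun p ↦ ?_, fun p q hpq ↦ ?_⟩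
  · have := hn (j p)
    rwa [(j p).2.2] at this
  · refine disjoint_left.2 fun a ha ha' ↦ hpq (j.injective (Subtype.ext ?_))
    exact hf a ha.1 ha'.1 (ha.2.trans ha'.2.symm)

/-- There are `2 ^ ℵ₁` sets with stationary differences. -/
theorem exists_family_isStationary_sdiff (hW : #W = ℵ₁) :
    ∃ A : Set (Set W), #A = 2 ^ ℵ₁ ∧ ∀ S ∈ A, ∀ T ∈ A, S ≠ T → IsStationary (S \ T) := by
  classical
  obtain ⟨Z, hZ, hd⟩ := exists_pairwise_disjoint_isStationary hW
  -- Each `i` contributes one of two disjoint stationary sets, so a disagreement at `i` makes both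
  -- differences stationary.
  let φ : Set W → Set W := fun I ↦ ⋃ i, Z (i, decide (i ∈ I))
  have h : ∀ I J, I ≠ J → IsStationary (φ I \ φ J) := fun I J hIJ ↦ by
    obtain ⟨i, hi⟩ : ∃ i, ¬ (i ∈ I ↔ i ∈ J) := by
      by_contra! h
      exact hIJ (Set.ext h)
    refine (hZ (i, decide (i ∈ I))).mono fun x hx ↦ ⟨mem_iUnion.2 ⟨i, hx⟩, fun hxJ ↦ ?_⟩
    obtain ⟨k, hk⟩ := mem_iUnion.1 hxJ
    refine disjoint_left.1 (hd fun heq ↦ hi ?_) hx hk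
    obtain ⟨rfl, h2⟩ := Prod.mk.inj heq
    simpa using h2
  have hinj : Function.Injective φ := fun I J hIJ ↦ by_contra fun hne ↦ by
    simpa [hIJ] using h I J hne
  refine ⟨range φ, ?_, ?_⟩
  · rw [Cardinal.mk_range_eq _ hinj, Cardinal.mk_set, hW]
  · rintro _ ⟨I, rfl⟩ _ ⟨J, rfl⟩ hne
    exact h I J fun hIJ ↦ hne (hIJ ▸ rfl)

end OmegaOneOrder

/-! ### The case of `ω₁` and the conclusion. -/

theorem Cardinal.mk_omegaOne : #OmegaOne = ℵ₁ := by
  rw [Cardinal.mk_Iio_ordinal]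
  simp

instance : OmegaOneOrder OmegaOne where
  exists_gt a := ⟨⟨Order.succ a.1, (Cardinal.isSuccLimit_omega 1).succ_lt a.2⟩,
    Order.lt_succ a.1⟩
  nonempty := ⟨⟨0, Ordinal.omega_pos 1⟩⟩
  countable_Iic a := by
    have h : (Iio (Order.succ a.1)).Countable := by
      rw [← Cardinal.le_aleph0_iff_set_countable, Cardinal.mk_Iio_ordinal,
        Cardinal.lift_le_aleph0, ← Order.lt_succ_iff, Cardinal.succ_aleph0, ← Cardinal.lt_ord,
        Cardinal.ord_aleph]
      exact (Cardinal.isSuccLimit_omega 1).succ_lt a.2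
    refine (h.preimage Subtype.val_injective).mono fun b hb ↦ ?_
    exact Order.lt_succ_of_le (show b.1 ≤ a.1 from hb)
  bddAbove_of_countable s hs := by
    have := hs.to_subtype
    refine ⟨⟨⨆ x : s, x.1.1, Ordinal.iSup_lt_omega_one fun x ↦ x.1.2⟩, fun x hx ↦ ?_⟩
    exact le_ciSup (f := fun x : s ↦ x.1.1) ⟨ω₁, by rintro _ ⟨y, rfl⟩; exact y.1.2.le⟩ ⟨x, hx⟩

open OmegaOneOrder in
theorem mainTheorem11 :
    ∃ A : Set (Set OmegaOne), #A = 2 ^ ℵ₁ ∧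
      ∀ S ∈ A, ∀ T ∈ A, S ≠ T →
        (¬ ∃ f : Ck T → Ck S, Continuous f ∧ IsOpenMap f ∧ Function.Surjective f) ∧
        (¬ ∃ e : Ck S → Ck T, Topology.IsEmbedding e) ∧
        (¬ ∃ u : Cp S →L[ℝ] Cp T, Function.Surjective u) ∧
        (¬ ∃ e : Cp S →L[ℝ] Cp T, Topology.IsEmbedding e) := by
  obtain ⟨A, hA, h⟩ := exists_family_isStationary_sdiff Cardinal.mk_omegaOne
  refine ⟨A, hA, fun S hS T hT hne ↦ ?_⟩
  have hST := h S hS T hT hne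
  have hTS := h T hT S hS hne.symm
  refine ⟨fun ⟨f, hf, hfo, _⟩ ↦ not_exists_isOpenMap hST hTS ⟨f, hf, hfo⟩,
    not_exists_isEmbedding hST hTS, fun ⟨u, hu⟩ ↦ not_surjective_of_isStationary_sdiff hTS u hu,
    fun ⟨e, he⟩ ↦ not_isEmbedding_of_isStationary_sdiff (hST.mono sdiff_subset) hTS e he⟩
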